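/- Let $k$ be an infinite field. Call $h=(h_0,h_1,\dots,h_e)$ a Gorenstein $h$-vector of socle degree $e$ if there are an integer $r\ge 0$ and a homogeneous ideal $I$ of the polynomial ring $R=k[x_1,\dots,x_r]$ (standard grading) such that $A=R/I$ is artinian and Gorenstein, i.e. its socle $\{a\in A : x_1a=\dots=x_ra=0\}$ is one-dimensional over $k$, with $\dim_k A_d=h_d$ for $0\le d\le e$, $h_e\ne 0$, and $A_d=0$ for all $d>e$. Let $h=(h_0,\dots,h_e)$ be a Gorenstein $h$-vector of socle degree $e$, and let $i$ be an integer with $0\le i\le \frac e2-1$. Then $$\binom{e-i+2}{2}-\binom{e-2i-1}{2}=\frac12(i+3)(2e-3i),$$ and if $$h_i<\binom{e-i+2}{2}-\binom{e-2i-1}{2},$$ then $h_{i+1}\ge h_i$. -/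

import Mathlib

attribute [local instance] MvPolynomial.gradedAlgebra

/-- The homogeneous component of degree `d` of `R ⧸ I`, where `R = k[x_1, …, x_r]` carries the
standard grading: the image of the forms of degree `d`. -/
noncomputable def gradedPiece {k : Type*} [Field k] {r : ℕ} (I : Ideal (MvPolynomial (Fin r) k)) (d : ℕ) :
    Submodule k (MvPolynomial (Fin r) k ⧸ I) :=
  (MvPolynomial.homogeneousSubmodule (Fin r) k d).map (Ideal.Quotient.mkₐ k I).toLinearMap

/-- The Hilbert function `d ↦ dim_k (R ⧸ I)_d` of `R ⧸ I`. -/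
noncomputable def hilbertFunction {k : Type*} [Field k] {r : ℕ}
    (I : Ideal (MvPolynomial (Fin r) k)) (d : ℕ) : ℕ :=
  Module.finrank k (gradedPiece I d)

/-- The socle `(0 : 𝔪)` of `A = R ⧸ I`, with `𝔪` the ideal generated by the classes of the
variables: the elements of `A` that are killed by every variable. -/
noncomputable def algebraSocle {k : Type*} [Field k] {r : ℕ} (I : Ideal (MvPolynomial (Fin r) k)) :
    Submodule k (MvPolynomial (Fin r) k ⧸ I) where
  carrier := {a | ∀ j : Fin r, Ideal.Quotient.mk I (MvPolynomial.X j) * a = 0}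
  zero_mem' := fun j => mul_zero _
  add_mem' := fun {a b} ha hb j => by
    have h1 := ha j
    have h2 := hb j
    rw [mul_add, h1, h2, add_zero]
  smul_mem' := fun c a ha j => by
    have h1 := ha j
    rw [mul_smul_comm, h1, smul_zero]

/-- `R ⧸ I` is a standard graded artinian Gorenstein `k`-algebra: `I` is homogeneous, `R ⧸ I` is
artinian, and its socle is one-dimensional over `k`. -/
structure IsArtinianGorenstein {k : Type*} [Field k] {r : ℕ}
    (I : Ideal (MvPolynomial (Fin r) k)) : Prop where
  homogeneous : I.IsHomogeneous (MvPolynomial.homogeneousSubmodule (Fin r) k)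
  artinian : IsArtinianRing (MvPolynomial (Fin r) k ⧸ I)
  finrank_socle : Module.finrank k (algebraSocle I) = 1

/-- `h = (h 0, h 1, …, h e)` (extended by zero) is a Gorenstein `h`-vector of socle degree `e` over
`k`: it is the Hilbert function of a standard graded artinian Gorenstein `k`-algebra
`k[x_1, …, x_r] ⧸ I`, and `e` is the last degree in which it does not vanish. -/
def IsGorensteinHVector (k : Type*) [Field k] (e : ℕ) (h : ℕ → ℕ) : Prop :=
  ∃ (r : ℕ) (I : Ideal (MvPolynomial (Fin r) k)),
    IsArtinianGorenstein I ∧ (∀ d, h d = hilbertFunction I d) ∧ h e ≠ 0 ∧ ∀ d, e < d → h d = 0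

/-! Suppose `h (i+1) < h i`. Let `A = R ⧸ I`, let `L` be any linear form, and put `B = A / L A`.
Gorenstein duality gives `h (e-i) = h i`, and shows that `L` has the same rank on `A_i → A_(i+1)` as
on `A_(e-i-1) → A_(e-i)`. Hence `dim B_(e-i) > dim B_(i+1)`. By Macaulay, once `dim B_j ≤ j` the
dimensions of `B` no longer grow, so `dim B_(i+1) ≥ i+2` and `dim B_(e-i) ≥ i+3`. As this holds for
every `L`, Green's restriction theorem forces `h (e-i) ≥ ∑_(t ≤ e-i) min (i+3) (t+1) =
(i+3)(2e-3i)/2`, contradicting the assumption on `h i`.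

Both the Macaulay bound (`finrank_sub_succ_le`) and the Green bound (`sum_min_le_finrank`) come from
`exists_add_finrank_le`. They use only inductions through the images `b • N` and lower
semicontinuity of rank in the linear form. The duality is `finrank_smul_gradedPiece`. -/

open scoped Pointwise
open Module Filter

/-! ### Zariski-generic coefficients over an infinite field. -/

/-- The filter generated by the nonempty Zariski-open subsets of `k ^ r`. -/
def zariskiGeneric (k : Type*) [Field k] (r : ℕ) : Filter (Fin r → k) where
  sets := {s | ∃ p : MvPolynomial (Fin r) k, p ≠ 0 ∧ ∀ a, MvPolynomial.eval a p ≠ 0 → a ∈ s}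
  univ_sets := ⟨1, one_ne_zero, fun _ _ => trivial⟩
  sets_of_superset := fun ⟨p, hp, h⟩ hst => ⟨p, hp, fun a ha => hst (h a ha)⟩
  inter_sets := fun ⟨p, hp, h⟩ ⟨q, hq, h'⟩ => ⟨p * q, mul_ne_zero hp hq, fun a ha => by
    rw [map_mul] at ha
    exact ⟨h a (left_ne_zero_of_mul ha), h' a (right_ne_zero_of_mul ha)⟩⟩

instance zariskiGeneric_neBot (k : Type*) [Field k] [Infinite k] (r : ℕ) :
    (zariskiGeneric k r).NeBot := by
  refine ⟨fun hbot => ?_⟩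
  have hmem : (∅ : Set (Fin r → k)) ∈ zariskiGeneric k r := by rw [hbot]; trivial
  obtain ⟨p, hp, h⟩ := hmem
  exact hp (MvPolynomial.funext fun a => by
    rw [map_zero]
    by_contra ha
    exact h a ha)

/-! ### Multiplication by linear forms: the theorems of Macaulay and Green. -/

section Multiplication

variable {k A : Type*} [Field k] [CommRing A] [Algebra k A] {r : ℕ}

/-- The linear combination of the family `x` with coefficients `a`. -/
def linForm (x : Fin r → A) (a : Fin r → k) : A := ∑ i, a i • x i

theorem linForm_single (x : Fin r → A) (i : Fin r) :
    linForm x (Pi.single i (1 : k)) = x i := by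
  classical
  simp [linForm, Pi.single_apply]

instance finite_pointwise_smul (b : A) (N : Submodule k A) [Module.Finite k N] :
    Module.Finite k (b • N : Submodule k A) :=
  inferInstanceAs (Module.Finite k (N.map _))

theorem finrank_pointwise_smul_le (b : A) (N : Submodule k A) [Module.Finite k N] :
    finrank k (b • N : Submodule k A) ≤ finrank k N :=
  Submodule.finrank_map_le _ _

theorem Submodule.finrank_map_add_finrank_inf_ker {V W : Type*} [AddCommGroup V] [Module k V]
    [AddCommGroup W] [Module k W] (f : V →ₗ[k] W) (N : Submodule k V) [Module.Finite k N] :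
    finrank k (N.map f) + finrank k (N ⊓ LinearMap.ker f : Submodule k V) = finrank k N := by
  have h := LinearMap.finrank_range_add_finrank_ker (f.domRestrict N)
  have hker : LinearMap.ker (f.domRestrict N) = (LinearMap.ker f).comap N.subtype := rfl
  rwa [LinearMap.range_domRestrict, hker,
    ← Submodule.finrank_map_subtype_eq, Submodule.map_comap_subtype] at h

theorem finrank_sup_eq_add_finrank_map_mkQ (Q V : Submodule k A) [Module.Finite k Q]
    [Module.Finite k V] :
    finrank k (Q ⊔ V : Submodule k A) = finrank k Q + finrank k (V.map Q.mkQ) := by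
  have h := Submodule.finrank_map_add_finrank_inf_ker Q.mkQ V
  rw [Submodule.ker_mkQ] at h
  have h' := Submodule.finrank_sup_add_finrank_inf_eq Q V
  rw [inf_comm] at h'
  omega

/-- Lower semicontinuity of rank: a maximal minor that is nonzero at `a₀` is a nonzero polynomial in
the coefficients `a`, and where it does not vanish the rank is at least that at `a₀`. -/
theorem eventually_finrank_sup_smul_le (x : Fin r → A) (Q U : Submodule k A)
    [Module.Finite k Q] [Module.Finite k U] (a₀ : Fin r → k) :
    ∀ᶠ a in zariskiGeneric k r, finrank k (Q ⊔ linForm x a₀ • U : Submodule k A) ≤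
      finrank k (Q ⊔ linForm x a • U : Submodule k A) := by
  classical
  set S := (linForm x a₀ • U : Submodule k A).map Q.mkQ with hS
  let v := Module.finBasis k S
  have hu : ∀ j, ∃ u ∈ U, Q.mkQ (linForm x a₀ * u) = v j := fun j => by
    obtain ⟨y, hy, hyv⟩ := (v j).2
    obtain ⟨u, hu, rfl⟩ := hy
    exact ⟨u, hu, hyv⟩
  choose u huU huv using hu
  have hv : LinearIndependent k (fun j => (v j : A ⧸ Q)) :=
    v.linearIndependent.map' S.subtype (Submodule.ker_subtype S)
  obtain ⟨g, hg⟩ := LinearMap.exists_leftInverse_of_injective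
    (Fintype.linearCombination k (fun j => (v j : A ⧸ Q)))
    (LinearMap.ker_eq_bot.2 hv.fintypeLinearCombination_injective)
  have hgv : ∀ j, g (v j) = Pi.single j 1 := fun j => by
    have := LinearMap.congr_fun hg (Pi.single j 1)
    simpa [Fintype.linearCombination_apply_single] using this
  -- In the coordinates `g`, this is the matrix of `u j ↦ linForm x a * u j` modulo `Q` with `a`
  -- indeterminate; at `a₀` it is the identity.
  let M : Matrix (Fin (finrank k S)) (Fin (finrank k S)) (MvPolynomial (Fin r) k) :=
    Matrix.of fun i j => ∑ l, MvPolynomial.X l * MvPolynomial.C (g (Q.mkQ (x l * u j)) i)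
  have hM : ∀ a, MvPolynomial.eval a M.det =
      (Matrix.of fun i j => g (Q.mkQ (linForm x a * u j)) i).det := fun a => by
    rw [RingHom.map_det]
    congr 1
    ext i j
    simp [M, linForm, Finset.sum_mul, -Submodule.mkQ_apply]
  refine ⟨M.det, fun h0 => ?_, fun a ha => ?_⟩
  · have h1 := hM a₀
    rw [h0, map_zero] at h1
    have h2 : (Matrix.of fun i j => g (Q.mkQ (linForm x a₀ * u j)) i) =
        (1 : Matrix (Fin (finrank k S)) (Fin (finrank k S)) k) := by
      ext i j
      rw [Matrix.of_apply, huv, hgv, Matrix.one_apply, Pi.single_apply]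
    rw [h2, Matrix.det_one] at h1
    exact zero_ne_one h1
  · rw [hM] at ha
    have hli := Matrix.linearIndependent_cols_of_det_ne_zero ha
    have hli' : LinearIndependent k (fun j => Q.mkQ (linForm x a * u j)) :=
      LinearIndependent.of_comp g hli
    have hcard := finrank_span_eq_card hli'
    rw [Fintype.card_fin] at hcard
    show finrank k (Q ⊔ linForm x a₀ • U : Submodule k A) ≤
      finrank k (Q ⊔ linForm x a • U : Submodule k A)
    rw [finrank_sup_eq_add_finrank_map_mkQ, finrank_sup_eq_add_finrank_map_mkQ, ← hS, ← hcard]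
    refine Nat.add_le_add_left (Submodule.finrank_mono ?_) _
    rw [Submodule.span_le]
    rintro _ ⟨j, rfl⟩
    exact ⟨_, Submodule.smul_mem_pointwise_smul _ _ _ (huU j), rfl⟩

/-- A sequence of finite-dimensional subspaces with `N 0 = 0` which is generated by `N 1` under
multiplication by the elements `x i`. -/
structure GeneratedInDegreeOne (x : Fin r → A) (N : ℕ → Submodule k A) : Prop where
  zero : N 0 = ⊥
  finite : ∀ n, Module.Finite k (N n)
  smul_le : ∀ n i, x i • N n ≤ N (n + 1)
  le_iSup : ∀ n, N (n + 2) ≤ ⨆ i, x i • N (n + 1)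

namespace GeneratedInDegreeOne

variable {x : Fin r → A} {N : ℕ → Submodule k A}

theorem linForm_smul_le (hN : GeneratedInDegreeOne x N) (a : Fin r → k) (n : ℕ) :
    linForm x a • N n ≤ N (n + 1) := by
  rintro _ ⟨y, hy, rfl⟩
  change linForm x a * y ∈ _
  rw [linForm, Finset.sum_mul]
  refine Submodule.sum_mem _ fun i _ => ?_
  rw [smul_mul_assoc]
  exact Submodule.smul_mem _ _ (hN.smul_le n i (Submodule.smul_mem_pointwise_smul _ _ _ hy))

/-- Stability under multiplication by any `b` is what lets the inductions below replace `N` by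
`linForm x b • N`, lowering the index by one. -/
theorem smul (hN : GeneratedInDegreeOne x N) (b : A) :
    GeneratedInDegreeOne x (fun n => b • N n) where
  zero := by rw [hN.zero, Submodule.smul_bot']
  finite n := by
    have := hN.finite n
    infer_instance
  smul_le n i := by
    rw [smul_comm]
    exact Submodule.map_mono (hN.smul_le n i)
  le_iSup n := by
    refine (Submodule.map_mono (hN.le_iSup n)).trans ?_
    rw [Submodule.map_iSup]
    refine iSup_mono fun i => ?_
    rw [smul_comm]
    exact le_rfl

/-- If no single linear form fills `N (n+1)` modulo `Q`, then some `linForm x b • N` inherits this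
failure one step lower. Each such descent makes an inclusion strict, so `n` descents gain `n`
dimensions over `Q`. -/
theorem exists_add_finrank_le [Infinite k] (hN : GeneratedInDegreeOne x N) (Q : Submodule k A)
    [Module.Finite k Q] (n : ℕ) (h : ∀ a : Fin r → k, ¬ N (n + 1) ≤ Q ⊔ linForm x a • N n) :
    ∃ a : Fin r → k, n + finrank k Q ≤ finrank k (Q ⊔ linForm x a • N n : Submodule k A) := by
  have := hN.finite
  induction n generalizing N with
  | zero =>
    refine ⟨0, ?_⟩
    rw [zero_add]
    exact Submodule.finrank_mono le_sup_left
  | succ n ih =>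
    have key : ∃ b : Fin r → k, ∀ a : Fin r → k,
        ¬ linForm x b • N (n + 1) ≤ Q ⊔ linForm x a • linForm x b • N n := by
      -- Otherwise each variable `x i` admits some good `a₀`. By semicontinuity a generic `a` is
      -- good for all `i` at once, and the `x i • N (n+1)` generate `N (n+2)`.
      by_contra! hcon
      have hgen : ∀ i, ∀ᶠ a in zariskiGeneric k r,
          x i • N (n + 1) ≤ Q ⊔ linForm x a • N (n + 1) := fun i => by
        obtain ⟨a₀, ha₀⟩ := hcon (Pi.single i 1)
        rw [linForm_single] at ha₀
        filter_upwards [eventually_finrank_sup_smul_le x Q (x i • N n) a₀] with a ha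
        have hle : Q ⊔ linForm x a • x i • N n ≤ Q ⊔ x i • N (n + 1) := by
          rw [smul_comm]
          exact sup_le_sup_left (Submodule.map_mono (hN.linForm_smul_le a n)) _
        have hle' : Q ⊔ x i • N (n + 1) ≤ Q ⊔ linForm x a₀ • x i • N n :=
          sup_le le_sup_left ha₀
        have heq := Submodule.eq_of_le_of_finrank_le hle ((Submodule.finrank_mono hle').trans ha)
        calc x i • N (n + 1) ≤ Q ⊔ x i • N (n + 1) := le_sup_right
          _ = Q ⊔ linForm x a • x i • N n := heq.symm
          _ ≤ _ := sup_le_sup_left (Submodule.map_mono (hN.smul_le n i)) _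
      obtain ⟨a, ha⟩ := (eventually_all.2 hgen).exists
      exact h a ((hN.le_iSup n).trans (iSup_le ha))
    obtain ⟨b, hb⟩ := key
    obtain ⟨a, ha⟩ := ih (hN.smul (linForm x b)) hb (hN.smul (linForm x b)).finite
    refine ⟨b, ?_⟩
    have hlt : Q ⊔ linForm x a • linForm x b • N n < Q ⊔ linForm x b • N (n + 1) := by
      refine lt_of_le_not_ge ?_ fun hge => hb a (le_sup_right.trans hge)
      rw [smul_comm]
      exact sup_le_sup_left (Submodule.map_mono (hN.linForm_smul_le a n)) _
    have := Submodule.finrank_lt_finrank_of_lt hlt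
    omega

/-- The general hyperplane restriction theorem of Green, for restrictions of small dimension. -/
theorem sum_min_le_finrank [Infinite k] (hN : GeneratedInDegreeOne x N) (c n : ℕ)
    (h : ∀ a : Fin r → k,
      c + finrank k (linForm x a • N n : Submodule k A) ≤ finrank k (N (n + 1))) :
    ∑ t ∈ Finset.range (n + 1), min c (t + 1) ≤ finrank k (N (n + 1)) := by
  have := hN.finite
  induction n generalizing N c with
  | zero =>
    have := h 0
    simp only [zero_add, Finset.range_one, Finset.sum_singleton] at this ⊢
    omega
  | succ n ih =>
    have key : ∃ b : Fin r → k, ∀ a : Fin r → k, min c (n + 1) +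
        finrank k (linForm x a • linForm x b • N n : Submodule k A) ≤
          finrank k (linForm x b • N (n + 1) : Submodule k A) := by
      by_contra! hcon
      -- With `b₀` of maximal rank and `a₀` violating the claim for `b₀`, the sum `Q ⊔ linForm x b •
      -- N (n+1)` is computed in two ways for generic `b`. It is small, since its two terms meet in
      -- at least `linForm x b • linForm x a₀ • N n`. It is large, since either it can be made to
      -- fill `N (n+2)` or `exists_add_finrank_le` applies.
      obtain ⟨b₀, hb₀⟩ : ∃ b₀ : Fin r → k, ∀ b : Fin r → k,
          finrank k (linForm x b • N (n + 1) : Submodule k A) ≤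
            finrank k (linForm x b₀ • N (n + 1) : Submodule k A) := by
        have hbdd : BddAbove (Set.range fun b : Fin r → k =>
            finrank k (linForm x b • N (n + 1) : Submodule k A)) :=
          ⟨finrank k (N (n + 1)), by
            rintro _ ⟨b, rfl⟩
            exact finrank_pointwise_smul_le _ _⟩
        obtain ⟨b₀, hb₀⟩ := Nat.sSup_mem (Set.range_nonempty _) hbdd
        exact ⟨b₀, fun b => (le_csSup hbdd ⟨b, rfl⟩).trans_eq hb₀.symm⟩
      obtain ⟨a₀, ha₀⟩ := hcon b₀
      set Q : Submodule k A := linForm x a₀ • N (n + 1) with hQ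
      have hsmall : ∀ᶠ b in zariskiGeneric k r,
          finrank k (Q ⊔ linForm x b • N (n + 1) : Submodule k A) <
            min c (n + 1) + finrank k Q := by
        filter_upwards [eventually_finrank_sup_smul_le x ⊥ (linForm x a₀ • N n) b₀] with b hb
        rw [bot_sup_eq, bot_sup_eq, smul_comm] at hb
        have h1 := Submodule.finrank_sup_add_finrank_inf_eq Q (linForm x b • N (n + 1))
        have h2 : linForm x b • linForm x a₀ • N n ≤ Q ⊓ linForm x b • N (n + 1) := by
          refine le_inf ?_ (Submodule.map_mono (hN.linForm_smul_le a₀ n))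
          rw [smul_comm]
          exact Submodule.map_mono (hN.linForm_smul_le b n)
        have h3 := Submodule.finrank_mono h2
        have h4 := hb₀ b
        omega
      have hlarge : ∃ a : Fin r → k, min c (n + 1) + finrank k Q ≤
          finrank k (Q ⊔ linForm x a • N (n + 1) : Submodule k A) := by
        by_cases hsup : ∃ a : Fin r → k, N (n + 2) ≤ Q ⊔ linForm x a • N (n + 1)
        · obtain ⟨a, ha⟩ := hsup
          have h1 := Submodule.finrank_mono ha
          have h2 : c + finrank k Q ≤ finrank k (N (n + 2)) := h a₀
          exact ⟨a, by omega⟩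
        · push Not at hsup
          obtain ⟨a, ha⟩ := hN.exists_add_finrank_le Q (n + 1) hsup
          exact ⟨a, by omega⟩
      obtain ⟨a, ha⟩ := hlarge
      obtain ⟨b, hb, hb'⟩ :=
        ((eventually_finrank_sup_smul_le x Q (N (n + 1)) a).and hsmall).exists
      omega
    obtain ⟨b, hb⟩ := key
    have h1 := ih (hN.smul (linForm x b)) (min c (n + 1)) hb (hN.smul (linForm x b)).finite
    have h2 := h b
    -- Capping `c` at `n + 1` is harmless, because `t + 1 ≤ n + 1` throughout the sum.
    have h3 : ∑ t ∈ Finset.range (n + 1), min (min c (n + 1)) (t + 1) =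
        ∑ t ∈ Finset.range (n + 1), min c (t + 1) :=
      Finset.sum_congr rfl fun t ht => by
        have := Finset.mem_range.1 ht
        omega
    rw [Finset.sum_range_succ]
    omega

/-- Macaulay's growth bound in the range where it says that a Hilbert function does not grow, for
the quotient by a linear form. -/
theorem finrank_sub_succ_le [Infinite k] (hN : GeneratedInDegreeOne x N) (b : Fin r → k) (n : ℕ)
    (h : finrank k (N (n + 1)) - finrank k (linForm x b • N n : Submodule k A) ≤ n) :
    finrank k (N (n + 2)) - finrank k (linForm x b • N (n + 1) : Submodule k A) ≤
      finrank k (N (n + 1)) - finrank k (linForm x b • N n : Submodule k A) := by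
  have := hN.finite
  set Q : Submodule k A := linForm x b • N n with hQ
  set Q' : Submodule k A := linForm x b • N (n + 1) with hQ'
  -- If no `a` worked, the gain of `n` dimensions over `Q` inside a proper subspace of `N (n+1)`
  -- would give a quotient of dimension at least `n + 1`.
  obtain ⟨a, ha⟩ : ∃ a : Fin r → k, N (n + 1) ≤ Q ⊔ linForm x a • N n := by
    by_contra! hcon
    obtain ⟨a, ha⟩ := hN.exists_add_finrank_le Q n hcon
    have hlt : Q ⊔ linForm x a • N n < N (n + 1) :=
      lt_of_le_not_ge (sup_le (hN.linForm_smul_le b n) (hN.linForm_smul_le a n)) (hcon a)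
    have := Submodule.finrank_lt_finrank_of_lt hlt
    omega
  -- Surjectivity of `linForm x a` persists in the next degree by generation, so it maps `N (n+1) /
  -- Q` onto `N (n+2) / Q'`. The rest is the dimension count for this.
  have hle : N (n + 2) ≤ Q' ⊔ linForm x a • N (n + 1) := by
    refine (hN.le_iSup n).trans (iSup_le fun i => (Submodule.map_mono ha).trans ?_)
    rw [Submodule.map_sup]
    refine sup_le_sup ?_ ?_
    · change x i • linForm x b • N n ≤ linForm x b • N (n + 1)
      rw [smul_comm]
      exact Submodule.map_mono (hN.smul_le n i)
    · change x i • linForm x a • N n ≤ linForm x a • N (n + 1)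
      rw [smul_comm]
      exact Submodule.map_mono (hN.smul_le n i)
  have h1 := Submodule.finrank_mono hle
  have h2 := Submodule.finrank_sup_add_finrank_inf_eq Q' (linForm x a • N (n + 1))
  have h3 : linForm x a • Q ≤ Q' ⊓ linForm x a • N (n + 1) := by
    refine le_inf ?_ (Submodule.map_mono (hN.linForm_smul_le b n))
    rw [hQ, smul_comm]
    exact Submodule.map_mono (hN.linForm_smul_le a n)
  have h4 := Submodule.finrank_mono h3
  have h5 : finrank k (linForm x a • N (n + 1) : Submodule k A) + finrank k Q ≤
      finrank k (N (n + 1)) + finrank k (linForm x a • Q : Submodule k A) := by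
    let f := (DistribSMul.toLinearMap k A (linForm x a))
    have e1 := Submodule.finrank_map_add_finrank_inf_ker f (N (n + 1))
    have e2 := Submodule.finrank_map_add_finrank_inf_ker f Q
    have e3 : finrank k (Q ⊓ LinearMap.ker f : Submodule k A) ≤
        finrank k (N (n + 1) ⊓ LinearMap.ker f : Submodule k A) :=
      Submodule.finrank_mono (inf_le_inf_right _ (hN.linForm_smul_le b n))
    change finrank k ((N (n + 1)).map f) + finrank k Q ≤
      finrank k (N (n + 1)) + finrank k (Q.map f)
    omega
  omega

theorem finrank_sub_le_of_le [Infinite k] (hN : GeneratedInDegreeOne x N) (b : Fin r → k)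
    {m n : ℕ} (hmn : m ≤ n)
    (h : finrank k (N (m + 1)) - finrank k (linForm x b • N m : Submodule k A) ≤ m) :
    finrank k (N (n + 1)) - finrank k (linForm x b • N n : Submodule k A) ≤
      finrank k (N (m + 1)) - finrank k (linForm x b • N m : Submodule k A) := by
  induction n, hmn using Nat.le_induction with
  | base => exact le_rfl
  | succ n hn ih => exact (hN.finrank_sub_succ_le b n (by omega)).trans ih

end GeneratedInDegreeOne

end Multiplication

/-! ### Graded pieces of the quotient algebra. -/

theorem LinearMap.finrank_range_flip {k U W : Type*} [Field k] [AddCommGroup U] [Module k U]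
    [AddCommGroup W] [Module k W] [Module.Finite k U] [Module.Finite k W]
    (B : U →ₗ[k] W →ₗ[k] k) :
    finrank k (LinearMap.range B.flip) = finrank k (LinearMap.range B) := by
  have h : B.flip = B.dualMap ∘ₗ (evalEquiv k W).toLinearMap := rfl
  rw [h, LinearMap.range_comp_of_range_eq_top _ (LinearEquiv.range _),
    LinearMap.finrank_range_dualMap_eq_finrank_range]

section GradedPiece

variable {k : Type*} [Field k] {r : ℕ} {I : Ideal (MvPolynomial (Fin r) k)}

theorem mul_mem_gradedPiece {m n : ℕ} {a b : MvPolynomial (Fin r) k ⧸ I}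
    (ha : a ∈ gradedPiece I m) (hb : b ∈ gradedPiece I n) : a * b ∈ gradedPiece I (m + n) := by
  obtain ⟨f, hf, rfl⟩ := ha
  obtain ⟨g, hg, rfl⟩ := hb
  exact ⟨f * g, MvPolynomial.IsHomogeneous.mul hf hg, map_mul (Ideal.Quotient.mk I) f g⟩

theorem one_mem_gradedPiece : (1 : MvPolynomial (Fin r) k ⧸ I) ∈ gradedPiece I 0 :=
  ⟨1, MvPolynomial.isHomogeneous_one _ _, map_one (Ideal.Quotient.mk I)⟩

theorem mk_X_mem_gradedPiece (i : Fin r) :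
    Ideal.Quotient.mk I (MvPolynomial.X i) ∈ gradedPiece I 1 :=
  ⟨_, MvPolynomial.isHomogeneous_X k i, rfl⟩

instance finite_gradedPiece (n : ℕ) : Module.Finite k (gradedPiece I n) := by
  have : Module.Finite k (MvPolynomial.homogeneousSubmodule (Fin r) k n) :=
    Module.Finite.iff_fg.2 (MvPolynomial.homogeneousSubmodule_fg _ _ n)
  unfold gradedPiece
  infer_instance

theorem gradedPiece_succ_le (n : ℕ) :
    gradedPiece I (n + 1) ≤ ⨆ i, Ideal.Quotient.mk I (MvPolynomial.X i) • gradedPiece I n := by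
  have h : MvPolynomial.homogeneousSubmodule (Fin r) k (n + 1) =
      Submodule.span k (Set.range MvPolynomial.X) *
        MvPolynomial.homogeneousSubmodule (Fin r) k n := by
    rw [← MvPolynomial.homogeneousSubmodule_one_pow, pow_succ',
      MvPolynomial.homogeneousSubmodule_one_pow, MvPolynomial.homogeneousSubmodule_one_eq_span_X]
  rw [gradedPiece, h, Submodule.map_le_iff_le_comap, Submodule.mul_le]
  intro f hf g hg
  induction hf using Submodule.span_induction with
  | mem f hf =>
    obtain ⟨i, rfl⟩ := hf
    refine Submodule.mem_iSup_of_mem i ?_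
    exact ⟨_, ⟨g, hg, rfl⟩, (map_mul _ _ _).symm⟩
  | zero => rw [zero_mul]; exact Submodule.zero_mem _
  | add f f' _ _ hf hf' => rw [add_mul]; exact Submodule.add_mem _ hf hf'
  | smul c f _ hf => rw [smul_mul_assoc]; exact Submodule.smul_mem _ _ hf

/-- The graded pieces of `R ⧸ I`, shifted by one and preceded by `0`. -/
noncomputable def shiftedPiece (I : Ideal (MvPolynomial (Fin r) k)) :
    ℕ → Submodule k (MvPolynomial (Fin r) k ⧸ I)
  | 0 => ⊥
  | n + 1 => gradedPiece I n

theorem generatedInDegreeOne_shiftedPiece :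
    GeneratedInDegreeOne (fun i => Ideal.Quotient.mk I (MvPolynomial.X i)) (shiftedPiece I) where
  zero := rfl
  finite n := by
    cases n with
    | zero => exact inferInstanceAs (Module.Finite k (⊥ : Submodule k _))
    | succ n => exact finite_gradedPiece n
  smul_le n i := by
    cases n with
    | zero => exact (Submodule.smul_bot' _).trans_le bot_le
    | succ n =>
      rintro _ ⟨a, ha, rfl⟩
      have := mul_mem_gradedPiece (mk_X_mem_gradedPiece i) ha
      rwa [add_comm] at this
  le_iSup n := gradedPiece_succ_le n

theorem linForm_mem_gradedPiece (a : Fin r → k) :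
    linForm (fun i => Ideal.Quotient.mk I (MvPolynomial.X i)) a ∈ gradedPiece I 1 :=
  Submodule.sum_mem _ fun i _ => Submodule.smul_mem _ _ (mk_X_mem_gradedPiece i)

theorem eq_zero_of_mem_gradedPiece_of_ne
    (hI : I.IsHomogeneous (MvPolynomial.homogeneousSubmodule (Fin r) k)) {m n : ℕ} (hmn : m ≠ n)
    {a : MvPolynomial (Fin r) k ⧸ I} (hm : a ∈ gradedPiece I m) (hn : a ∈ gradedPiece I n) :
    a = 0 := by
  obtain ⟨f, hf, rfl⟩ := hm
  obtain ⟨g, hg, hgf⟩ := hn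
  have hfg : f - g ∈ I := Ideal.Quotient.eq.1 hgf.symm
  have h := hI m hfg
  rw [DirectSum.decompose_sub, DirectSum.sub_apply, AddSubgroupClass.coe_sub,
    DirectSum.decompose_of_mem_same _ hf, DirectSum.decompose_of_mem_ne _ hg hmn.symm,
    sub_zero] at h
  exact Ideal.Quotient.eq_zero_iff_mem.2 h

end GradedPiece

/-! ### Duality in a graded Gorenstein algebra. -/

namespace IsArtinianGorenstein

variable {k : Type*} [Field k] {r : ℕ} {I : Ideal (MvPolynomial (Fin r) k)} {e : ℕ}

theorem gradedPiece_le_algebraSocle (htop : gradedPiece I (e + 1) = ⊥) :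
    gradedPiece I e ≤ algebraSocle I := fun a ha j => by
  have h := mul_mem_gradedPiece (mk_X_mem_gradedPiece j) ha
  rw [add_comm, htop] at h
  exact (Submodule.mem_bot k).1 h

theorem algebraSocle_eq_gradedPiece (hI : IsArtinianGorenstein I) (he : gradedPiece I e ≠ ⊥)
    (htop : gradedPiece I (e + 1) = ⊥) : gradedPiece I e = algebraSocle I := by
  have : Module.Finite k (algebraSocle I) :=
    Module.finite_of_finrank_eq_succ (n := 0) hI.finrank_socle
  refine Submodule.eq_of_le_of_finrank_le (gradedPiece_le_algebraSocle htop) ?_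
  rw [hI.finrank_socle]
  exact Submodule.one_le_finrank_iff.2 he

/-- The socle lives only in degree `e`, so a nonzero form of lower degree survives multiplication by
some variable; iterating climbs to degree `e`. -/
theorem exists_mul_ne_zero (hI : IsArtinianGorenstein I) (he : gradedPiece I e ≠ ⊥)
    (htop : gradedPiece I (e + 1) = ⊥) (n : ℕ) {m : ℕ} (hmn : m + n = e)
    {a : MvPolynomial (Fin r) k ⧸ I} (ha : a ∈ gradedPiece I m) (ha0 : a ≠ 0) :
    ∃ b ∈ gradedPiece I n, a * b ≠ 0 := by
  induction n generalizing m a with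
  | zero => exact ⟨1, one_mem_gradedPiece, by rwa [mul_one]⟩
  | succ n ih =>
    have hsoc : a ∉ algebraSocle I := fun h => by
      rw [← hI.algebraSocle_eq_gradedPiece he htop] at h
      exact ha0 (eq_zero_of_mem_gradedPiece_of_ne hI.homogeneous (by omega) ha h)
    obtain ⟨j, hj⟩ : ∃ j, Ideal.Quotient.mk I (MvPolynomial.X j) * a ≠ 0 := by
      by_contra! h
      exact hsoc h
    obtain ⟨b, hb, hb0⟩ :=
      ih (m := 1 + m) (by omega) (mul_mem_gradedPiece (mk_X_mem_gradedPiece j) ha) hj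
    refine ⟨Ideal.Quotient.mk I (MvPolynomial.X j) * b, ?_, ?_⟩
    · rw [add_comm]
      exact mul_mem_gradedPiece (mk_X_mem_gradedPiece j) hb
    · rwa [mul_left_comm, ← mul_assoc]

/-- Multiplication by a form is self-adjoint for the duality of a graded Gorenstein algebra. -/
theorem finrank_smul_gradedPiece (hI : IsArtinianGorenstein I) (he : gradedPiece I e ≠ ⊥)
    (htop : gradedPiece I (e + 1) = ⊥) {d m n : ℕ} (hdmn : d + m + n = e)
    {b : MvPolynomial (Fin r) k ⧸ I} (hb : b ∈ gradedPiece I d) :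
    finrank k (b • gradedPiece I m : Submodule k (MvPolynomial (Fin r) k ⧸ I)) =
      finrank k (b • gradedPiece I n : Submodule k (MvPolynomial (Fin r) k ⧸ I)) := by
  obtain ⟨φ, hφ⟩ : ∃ φ : (MvPolynomial (Fin r) k ⧸ I) →ₗ[k] k,
      ∀ z ∈ gradedPiece I e, φ z = 0 → z = 0 := by
    have h1 : finrank k (gradedPiece I e) = 1 := by
      rw [hI.algebraSocle_eq_gradedPiece he htop, hI.finrank_socle]
    obtain ⟨φ, hφ⟩ := LinearMap.exists_extend (LinearEquiv.ofFinrankEq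
      (gradedPiece I e) k (by rw [h1, finrank_self])).toLinearMap
    refine ⟨φ, fun z hz h0 => ?_⟩
    have h2 := LinearMap.congr_fun hφ ⟨z, hz⟩
    rw [LinearMap.comp_apply, Submodule.subtype_apply, h0] at h2
    exact congrArg Subtype.val ((LinearEquiv.map_eq_zero_iff _).1 h2.symm)
  -- The form `(u, w) ↦ φ (b u w)` has the rank of multiplication by `b` on the left factor, since
  -- the pairing into degree `e` is nondegenerate. Exchanging the factors transposes it.
  let B (m n : ℕ) : gradedPiece I m →ₗ[k] gradedPiece I n →ₗ[k] k :=
    ((LinearMap.mul k (MvPolynomial (Fin r) k ⧸ I)).compr₂ φ ∘ₗ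
      LinearMap.mulLeft k b).domRestrict₁₂ (gradedPiece I m) (gradedPiece I n)
  have hB : ∀ m n u w, B m n u w = φ (b * u * w) := fun _ _ _ _ => rfl
  have hrank : ∀ m n, d + m + n = e → finrank k (LinearMap.range (B m n)) =
      finrank k (b • gradedPiece I m : Submodule k (MvPolynomial (Fin r) k ⧸ I)) := by
    intro m n hmn
    have h1 := LinearMap.finrank_range_add_finrank_ker (B m n)
    let f := (LinearMap.mulLeft k b).domRestrict (gradedPiece I m)
    have h2 := LinearMap.finrank_range_add_finrank_ker f
    have hker : LinearMap.ker (B m n) = LinearMap.ker f := by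
      ext u
      rw [LinearMap.mem_ker, LinearMap.mem_ker]
      have hf : f u = b * u := rfl
      rw [hf]
      constructor
      · intro hu
        by_contra h0
        have hmem := mul_mem_gradedPiece hb u.2
        obtain ⟨w, hw, hw0⟩ := hI.exists_mul_ne_zero he htop n hmn hmem h0
        refine hw0 (hφ _ ?_ ?_)
        · rw [← hmn]
          exact mul_mem_gradedPiece hmem hw
        · exact LinearMap.congr_fun hu ⟨w, hw⟩
      · intro hu
        ext w
        rw [hB, hu, zero_mul, map_zero, LinearMap.zero_apply]
    have hrange : LinearMap.range f = b • gradedPiece I m := LinearMap.range_domRestrict _ _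
    rw [hker] at h1
    rw [hrange] at h2
    omega
  have hflip : (B m n).flip = B n m := by
    ext u w
    rw [LinearMap.flip_apply, hB, hB, mul_right_comm]
  rw [← hrank m n hdmn, ← hrank n m (by omega), ← hflip, LinearMap.finrank_range_flip]

end IsArtinianGorenstein

/-! ### The numerical bound and the conclusion. -/

theorem two_mul_sum_range_min {c n : ℕ} (hcn : c ≤ n) :
    2 * (∑ t ∈ Finset.range n, min c (t + 1) : ℤ) = c * (2 * n + 1 - c) := by
  induction n, hcn using Nat.le_induction with
  | base =>
    have h : ∀ m ≤ c, 2 * (∑ t ∈ Finset.range m, min c (t + 1) : ℤ) = m * (m + 1) := by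
      intro m hm
      induction m with
      | zero => simp
      | succ m ih =>
        rw [Finset.sum_range_succ, mul_add, ih (by omega), min_eq_right (by omega)]
        push_cast
        ring
    rw [h c le_rfl]
    ring
  | succ n hn ih =>
    rw [Finset.sum_range_succ, mul_add, ih, min_eq_left (by omega)]
    push_cast
    ring

theorem IsGorensteinHVector.le_succ_of_two_mul_lt {k : Type*} [Field k] [Infinite k] {e : ℕ}
    {h : ℕ → ℕ} (hh : IsGorensteinHVector k e h) {i : ℕ} (hi : 2 * i + 2 ≤ e)
    (hlt : 2 * (h i : ℤ) < (i + 3) * (2 * e - 3 * i)) : h i ≤ h (i + 1) := by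
  obtain ⟨r, I, hI, hH, he0, htop⟩ := hh
  have he : gradedPiece I e ≠ ⊥ := fun h0 => he0 (by
    rw [hH, hilbertFunction, h0, finrank_bot])
  have htop' : gradedPiece I (e + 1) = ⊥ := by
    rw [← Submodule.finrank_eq_zero]
    exact (hH _).symm.trans (htop _ (Nat.lt_succ_self e))
  -- Symmetry of `h` is the duality for multiplication by `1`, a form of degree `0`.
  have hsymm : ∀ {m n : ℕ}, m + n = e → h m = h n := fun {m n} hmn => by
    have h1 := hI.finrank_smul_gradedPiece he htop' (d := 0) (m := m) (n := n) (by omega)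
      (b := 1) one_mem_gradedPiece
    rwa [one_smul, one_smul, ← hilbertFunction, ← hilbertFunction, ← hH, ← hH] at h1
  by_contra! hdec
  obtain ⟨d, rfl⟩ : ∃ d, e = i + (d + 1) := ⟨e - i - 1, by omega⟩
  have hN := generatedInDegreeOne_shiftedPiece (I := I)
  have hfin := hN.finite
  -- Here `d + 1 = e - i`. The shift makes index `n + 1` stand for degree `n`, so `m = i + 1` below
  -- is Macaulay's condition `dim B_(i+1) ≤ i + 1`. If it held, it would contradict `hdec`, because
  -- the two ranks in `hdual` agree.
  have hgreen := hN.sum_min_le_finrank (i + 3) (d + 1) fun a => by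
    set L := linForm (fun i => Ideal.Quotient.mk I (MvPolynomial.X i)) a with hL
    change i + 3 + finrank k (L • gradedPiece I d : Submodule k _) ≤ hilbertFunction I (d + 1)
    have hdual := hI.finrank_smul_gradedPiece he htop' (d := 1) (m := i) (n := d) (by omega)
      (linForm_mem_gradedPiece a)
    rw [← hL] at hdual
    have hmac := hN.finrank_sub_le_of_le a (m := i + 1) (n := d + 1) (by omega)
    have hle := Submodule.finrank_mono (hN.linForm_smul_le a (i + 1))
    change hilbertFunction I (i + 1) - finrank k (L • gradedPiece I i : Submodule k _) ≤ i + 1 →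
      hilbertFunction I (d + 1) - finrank k (L • gradedPiece I d : Submodule k _) ≤
      hilbertFunction I (i + 1) - finrank k (L • gradedPiece I i : Submodule k _) at hmac
    change finrank k (L • gradedPiece I i : Submodule k _) ≤ hilbertFunction I (i + 1) at hle
    rw [← hH] at hmac hle ⊢
    rw [← hH] at hmac
    have h1 : h (d + 1) = h i := hsymm (by omega)
    omega
  have hsum := two_mul_sum_range_min (c := i + 3) (n := d + 1 + 1) (by omega)
  change _ ≤ hilbertFunction I (d + 1) at hgreen
  rw [← hH, hsymm (m := d + 1) (n := i) (by omega)] at hgreen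
  have hgreen' : (∑ t ∈ Finset.range (d + 1 + 1), min ((i + 3 : ℕ) : ℤ) (t + 1) : ℤ) ≤ h i := by
    exact_mod_cast hgreen
  push_cast at hlt hsum hgreen'
  nlinarith

theorem proposition2p5 (k : Type*) [Field k] [Infinite k] (e : ℕ) (h : ℕ → ℕ)
    (hh : IsGorensteinHVector k e h) (i : ℕ) (hi : (i : ℚ) ≤ (e : ℚ) / 2 - 1) :
    ((e - i + 2).choose 2 : ℚ) - ((e - 2 * i - 1).choose 2 : ℚ)
        = ((i : ℚ) + 3) * (2 * (e : ℚ) - 3 * (i : ℚ)) / 2 ∧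
      ((h i : ℚ) < ((e - i + 2).choose 2 : ℚ) - ((e - 2 * i - 1).choose 2 : ℚ) →
        h i ≤ h (i + 1)) := by
  have hi' : 2 * i + 2 ≤ e := by
    have : (2 * i + 2 : ℚ) ≤ e := by linarith
    exact_mod_cast this
  have hid : ((e - i + 2).choose 2 : ℚ) - ((e - 2 * i - 1).choose 2 : ℚ)
      = ((i : ℚ) + 3) * (2 * (e : ℚ) - 3 * (i : ℚ)) / 2 := by
    -- Writing `e = 2i + 2 + n` shows that none of the natural-number subtractions truncates.
    obtain ⟨n, rfl⟩ := Nat.exists_eq_add_of_le hi'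
    rw [show 2 * i + 2 + n - i + 2 = i + n + 4 by omega,
      show 2 * i + 2 + n - 2 * i - 1 = n + 1 by omega, Nat.cast_choose_two, Nat.cast_choose_two]
    push_cast
    ring
  refine ⟨hid, fun hlt => hh.le_succ_of_two_mul_lt hi' ?_⟩
  rw [hid, lt_div_iff₀ two_pos, mul_comm] at hlt
  exact_mod_cast hlt
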